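/- Let $n\ge 1$, let $\alpha_1,\dots,\alpha_n>-\tfrac12$ be real numbers, $a_i=2\alpha_i+1$ and $|a|=\sum_{i=1}^n a_i$. Let $\mathbb{R}^n_+=\{x\in\mathbb{R}^n : x_i\ge 0,\ i=1,\dots,n\}$, let $\lambda_a$ be the measure $d\lambda_a(x)=x^a\,dx=\prod_{i=1}^n x_i^{a_i}\,dx$ on $\mathbb{R}^n_+$, and for $1\le q<\infty$ let $\|f\|_{q,a}=\big(\int_{\mathbb{R}^n_+}|f|^q\,d\lambda_a\big)^{1/q}$, with $L^q_a$ the space of measurable $f$ with $\|f\|_{q,a}<\infty$. For a nonnegative measurable function $f$ and $x,t\in\mathbb{R}^n_+$ the Bessel translation is $$T^t_a f(x)=\int_{[0,\pi]^n} f\Big(\sqrt{x_1^2+t_1^2-2x_1t_1\cos\vartheta_1},\dots,\sqrt{x_n^2+t_n^2-2x_nt_n\cos\vartheta_n}\Big)\prod_{i=1}^n\frac{\Gamma(\alpha_i+1)}{\sqrt{\pi}\,\Gamma(\alpha_i+\frac12)}\sin^{2\alpha_i}\vartheta_i\,d\vartheta_1\cdots d\vartheta_n ,$$ and the Bessel convolution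 of nonnegative functions is $(\kappa*_a f)(x)=\int_{\mathbb{R}^n_+}T_a^t\kappa(x)\,f(t)\,d\lambda_a(t)\in[0,\infty]$. A radially decreasing kernel is a function $\kappa(x)=g(|x|)$ on $\mathbb{R}^n$, where $|\cdot|$ is the Euclidean norm and $g:[0,\infty)\to[0,\infty]$ is lower semicontinuous and nonincreasing with $\int_0^1 g(t)\,t^{n+|a|-1}\,dt<\infty$. For $1\le p<\infty$ and $E\subset\mathbb{R}^n_+$ the B-$p$ capacity with respect to $\kappa$ is $$C_{p,\kappa}(E)=\inf\big\{\|f\|_{p,a}^p : f\in L^p_a,\ f\ge 0,\ (\kappa*_a f)(x)\ge 1 \text{ for all } x\in E\big\}\in[0,\infty]$$ (with $\inf\emptyset=\infty$). Let $1<p<\infty$, $\frac1p+\frac1{p'}=1$, let $\kappa$ be a radially decreasing kernel, and let $B(0,1)$ be the open Euclidean unit ball. Then: (1) if $\|\kappa\|_{p',a}<\infty$, then $C_{p,\kappa}(\{y\})>0$ for every $y$ in the interior of $\mathbb{R}^n_+$; (2) if $\int_{\mathbb{R}^n_+\setminus B(0,1)}\kappa^{p'}\,d\lambda_a=\infty$,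 then $C_{p,\kappa}(E)=0$ for every $E\subset\mathbb{R}^n_+$; (3) if $\int_{\mathbb{R}^n_+\setminus B(0,1)}\kappa^{p'}\,d\lambda_a<\infty$, $E\subset\mathbb{R}^n_+$ is (Lebesgue) measurable and $C_{p,\kappa}(E)=0$, then $\lambda_a(E)=0$. -/

import Mathlib

open MeasureTheory
open scoped ENNReal

namespace BesselCapacity

/-- The closed orthant `ℝⁿ₊ = {x : xᵢ ≥ 0 for all i}` in Euclidean space. -/
def orthant (n : ℕ) : Set (EuclideanSpace ℝ (Fin n)) :=
  {x | ∀ i, 0 ≤ x i}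

/-- The weight exponents `aᵢ = 2 αᵢ + 1`. -/
def weight {n : ℕ} (α : Fin n → ℝ) (i : Fin n) : ℝ :=
  2 * α i + 1

/-- The measure `dλ_a(x) = xᵃ dx` on `ℝⁿ₊`, where `xᵃ = ∏ᵢ xᵢ ^ aᵢ`, as a measure on `ℝⁿ`
carried by `ℝⁿ₊`. -/
noncomputable def lamA {n : ℕ} (α : Fin n → ℝ) : Measure (EuclideanSpace ℝ (Fin n)) :=
  (volume.restrict (orthant n)).withDensity
    (fun x => ENNReal.ofReal (∏ i, x i ^ weight α i))

/-- The angular measure `Γ(α+1) / (√π Γ(α+1/2)) · sin^{2α} ϑ dϑ` on `[0, π]`. -/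
noncomputable def angleMeasure (α : ℝ) : Measure ℝ :=
  (volume.restrict (Set.Icc 0 Real.pi)).withDensity
    (fun θ => ENNReal.ofReal
      (Real.Gamma (α + 1) / (Real.sqrt Real.pi * Real.Gamma (α + 1 / 2))
        * Real.sin θ ^ (2 * α)))

/-- The point with coordinates `√(xᵢ² + tᵢ² - 2 xᵢ tᵢ cos ϑᵢ)`. -/
noncomputable def besselShift {n : ℕ} (x t : EuclideanSpace ℝ (Fin n)) (θ : Fin n → ℝ) :
    EuclideanSpace ℝ (Fin n) :=
  WithLp.toLp 2
    (fun i => Real.sqrt (x i ^ 2 + t i ^ 2 - 2 * x i * t i * Real.cos (θ i)))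

/-- The Bessel translation `T_a^t f (x)` of a nonnegative function: the coordinatewise
translations, performed in all the variables, as one integral over `[0, π]ⁿ`. -/
noncomputable def besselTranslation {n : ℕ} (α : Fin n → ℝ) (t : EuclideanSpace ℝ (Fin n))
    (f : EuclideanSpace ℝ (Fin n) → ℝ≥0∞) (x : EuclideanSpace ℝ (Fin n)) : ℝ≥0∞ :=
  ∫⁻ θ, f (besselShift x t θ) ∂(Measure.pi (fun i => angleMeasure (α i)))

/-- The Bessel convolution `(κ *_a f)(x) = ∫ T_a^t κ(x) f(t) dλ_a(t)` of nonnegative functions. -/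
noncomputable def besselConv {n : ℕ} (α : Fin n → ℝ)
    (κ f : EuclideanSpace ℝ (Fin n) → ℝ≥0∞) (x : EuclideanSpace ℝ (Fin n)) : ℝ≥0∞ :=
  ∫⁻ t, besselTranslation α t κ x * f t ∂(lamA α)

/-- `κ` is a radially decreasing kernel: `κ(x) = g(|x|)` with `g : [0, ∞) → [0, ∞]`
nonincreasing, lower semicontinuous, and `∫₀¹ g(t) t^{n+|a|-1} dt < ∞`.
(The integral condition forces `g` to be finite on `(0, ∞)`; only `g 0 = ∞` is possible.
The values of `g` on negative numbers play no role.) -/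
def IsRadiallyDecreasingKernel {n : ℕ} (α : Fin n → ℝ)
    (κ : EuclideanSpace ℝ (Fin n) → ℝ≥0∞) : Prop :=
  ∃ g : ℝ → ℝ≥0∞,
    AntitoneOn g (Set.Ici 0) ∧
    LowerSemicontinuousOn g (Set.Ici 0) ∧
    (∫⁻ t in Set.Ioo (0 : ℝ) 1,
      g t * ENNReal.ofReal (t ^ ((n : ℝ) + ∑ i, weight α i - 1))) < ∞ ∧
    ∀ x, κ x = g ‖x‖

/-- The capacity
`C_{p,κ}(E) = inf {‖f‖_{p,a}^p : 0 ≤ f ∈ L^p_a, κ *_a f ≥ 1 everywhere on E}`,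
with values in `[0, ∞]`. -/
noncomputable def capacity {n : ℕ} (α : Fin n → ℝ) (p : ℝ)
    (κ : EuclideanSpace ℝ (Fin n) → ℝ≥0∞) (E : Set (EuclideanSpace ℝ (Fin n))) : ℝ≥0∞ :=
  sInf {c | ∃ f : EuclideanSpace ℝ (Fin n) → ℝ,
    MemLp f (ENNReal.ofReal p) (lamA α) ∧ (∀ x, 0 ≤ f x) ∧
    (∀ x ∈ E, 1 ≤ besselConv α κ (fun t => ENNReal.ofReal (f t)) x) ∧
    c = eLpNorm f (ENNReal.ofReal p) (lamA α) ^ p}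

end BesselCapacity

/-!
The proof rests on one fact about the Bessel translation, `map_besselShift`: for fixed `x`, the map
`(t, θ) ↦ besselShift x t θ` pushes `λ_a ⊗ (angular measure)` forward to a constant multiple of
`λ_a`. In each coordinate, `(t, θ)` are polar coordinates in the upper half plane; there the measure
is `v ^ (2α) du dv`, which is invariant under `u ↦ u + x`, and the shifted coordinate is the distance
to `(x, 0)`. Since the shift is also symmetric in `x` and `t`, Hölder's inequality on the product
space gives `κ *_a f ≤ C ‖κ‖_{p'} ‖f‖_p` pointwise (`besselConv_le_holder`) and Young's inequality
`‖κ *_a f‖_p ≤ C ‖κ‖₁ ‖f‖_p` (`lintegral_besselConv_rpow_le`). The value of `C` is irrelevant, so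
the total mass of the angular measure only needs to be finite and nonzero.

* If `κ ∈ L^{p'}`, the pointwise bound prevents the norms of test functions of a point from tending
  to zero.
* If `κ ^ p'` is not integrable at infinity, then for `x` in a ball of radius `R` and `‖t‖ ≥ R` the
  translated kernel dominates a multiple of `κ (2t)`. By homogeneity of `λ_a` this is not in `L^{p'}`
  far out, so test functions of arbitrarily small norm exist for each ball, and countably many
  balls cover everything.
* If `κ ^ p'` is integrable at infinity, split `κ` along the unit ball. The outer part contributes
  uniformly little to `κ *_a f` when `‖f‖_p` is small; the inner part is integrable (polar
  decomposition of `λ_a`, `setLIntegral_closedBall_radial`), and Young's and Chebyshev's inequalities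
  bound the measure of the set.
-/

namespace BesselCapacity

/-! ### Bessel translation in one coordinate -/

/-- The measure `t ^ a dt` on `[0, ∞)`, as a measure on `ℝ`. -/
noncomputable def coordMeasure (a : ℝ) : Measure ℝ :=
  (volume.restrict (Set.Ici 0)).withDensity (fun t => ENNReal.ofReal (t ^ a))

/-- One coordinate of `besselShift`, as a function of the pair `(t, θ)`. -/
noncomputable def coordShift (x : ℝ) (p : ℝ × ℝ) : ℝ :=
  Real.sqrt (x ^ 2 + p.1 ^ 2 - 2 * x * p.1 * Real.cos p.2)

lemma measurable_coordShift (x : ℝ) : Measurable (coordShift x) := by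
  unfold coordShift; fun_prop

instance (a : ℝ) : SigmaFinite (coordMeasure a) := by unfold coordMeasure; infer_instance

instance (α : ℝ) : SigmaFinite (angleMeasure α) := by unfold angleMeasure; infer_instance

lemma angleConst_pos {α : ℝ} (hα : -(1 / 2 : ℝ) < α) :
    0 < Real.Gamma (α + 1) / (Real.sqrt Real.pi * Real.Gamma (α + 1 / 2)) := by
  have h1 := Real.Gamma_pos_of_pos (show 0 < α + 1 by linarith)
  have h2 := Real.Gamma_pos_of_pos (show 0 < α + 1 / 2 by linarith)
  have := Real.pi_pos
  positivity

lemma lintegral_sin_rpow_lt_top {s : ℝ} (hs : -1 < s) :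
    ∫⁻ θ in Set.Icc 0 Real.pi, ENNReal.ofReal (Real.sin θ ^ s) < ∞ := by
  have hpi := Real.pi_pos
  rcases le_or_gt 0 s with h0 | h0
  · calc ∫⁻ θ in Set.Icc 0 Real.pi, ENNReal.ofReal (Real.sin θ ^ s)
        ≤ ∫⁻ θ in Set.Icc 0 Real.pi, 1 := by
          refine setLIntegral_mono measurable_const fun θ hθ => ?_
          exact ENNReal.ofReal_le_one.2 (Real.rpow_le_one (Real.sin_nonneg_of_mem_Icc hθ)
            (Real.sin_le_one θ) h0)
      _ < ∞ := by simp
  · have hI : IntegrableOn (fun θ : ℝ => θ ^ s) (Set.Ioc 0 (Real.pi / 2)) :=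
      (intervalIntegrable_iff_integrableOn_Ioc_of_le (by positivity)).1
        (intervalIntegral.intervalIntegrable_rpow' hs)
    have half : ∫⁻ θ in Set.Ioc 0 (Real.pi / 2), ENNReal.ofReal (Real.sin θ ^ s) < ∞ := by
      calc ∫⁻ θ in Set.Ioc 0 (Real.pi / 2), ENNReal.ofReal (Real.sin θ ^ s)
          ≤ ∫⁻ θ in Set.Ioc 0 (Real.pi / 2),
              ENNReal.ofReal ((2 / Real.pi) ^ s * θ ^ s) := by
            refine setLIntegral_mono (by fun_prop) fun θ hθ => ?_
            refine ENNReal.ofReal_le_ofReal ?_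
            rw [← Real.mul_rpow (by positivity) hθ.1.le]
            exact Real.rpow_le_rpow_of_nonpos (mul_pos (by positivity) hθ.1)
              (Real.mul_le_sin hθ.1.le hθ.2) h0.le
        _ < ∞ := by
            have := (hI.const_mul ((2 / Real.pi) ^ s)).2
            refine lt_of_le_of_lt (lintegral_mono fun θ => ?_) this
            exact Real.ofReal_le_enorm _
    -- The reflection `θ ↦ π - θ` exchanges the two halves.
    have half' : ∫⁻ θ in Set.Ico (Real.pi / 2) Real.pi, ENNReal.ofReal (Real.sin θ ^ s) < ∞ := by
      have e := (Measure.measurePreserving_sub_left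
        (volume : Measure ℝ) Real.pi).setLIntegral_comp_preimage_emb
        (Homeomorph.subLeft Real.pi).measurableEmbedding
        (fun θ => ENNReal.ofReal (Real.sin θ ^ s)) (Set.Ioc 0 (Real.pi / 2))
      have : (fun x => Real.pi - x) ⁻¹' Set.Ioc 0 (Real.pi / 2) = Set.Ico (Real.pi / 2) Real.pi := by
        rw [Set.preimage_const_sub_Ioc]; congr 1 <;> ring
      rw [this] at e
      simp only [Real.sin_pi_sub] at e
      rw [e]; exact half
    have hsub : Set.Icc 0 Real.pi ⊆
        (Set.Ioc 0 (Real.pi / 2) ∪ Set.Ico (Real.pi / 2) Real.pi) ∪ ({0} ∪ {Real.pi}) := by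
      intro θ hθ
      simp only [Set.mem_union, Set.mem_Ioc, Set.mem_Ico, Set.mem_singleton_iff]
      rcases eq_or_lt_of_le hθ.1 with h | h
      · exact Or.inr (Or.inl h.symm)
      rcases eq_or_lt_of_le hθ.2 with h' | h'
      · exact Or.inr (Or.inr h')
      rcases le_total θ (Real.pi / 2) with h2 | h2 <;> grind
    calc _ ≤ _ := lintegral_mono_set hsub
      _ ≤ _ := (lintegral_union_le _ _ _).trans
          (add_le_add (lintegral_union_le _ _ _) (lintegral_union_le _ _ _))
      _ < ∞ := by simp [half, half']

lemma angleMeasure_univ_lt_top {α : ℝ} (hα : -(1 / 2 : ℝ) < α) :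
    angleMeasure α Set.univ < ∞ := by
  rw [angleMeasure, withDensity_apply _ MeasurableSet.univ, Measure.restrict_univ]
  simp_rw [ENNReal.ofReal_mul (angleConst_pos hα).le]
  rw [lintegral_const_mul _ (by fun_prop)]
  exact ENNReal.mul_lt_top ENNReal.ofReal_lt_top (lintegral_sin_rpow_lt_top (by linarith))

lemma angleMeasure_univ_pos {α : ℝ} (hα : -(1 / 2 : ℝ) < α) :
    angleMeasure α Set.univ ≠ 0 := by
  rw [angleMeasure, withDensity_apply _ MeasurableSet.univ, Measure.restrict_univ]
  have hpi := Real.pi_pos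
  rw [← pos_iff_ne_zero]
  refine lt_of_lt_of_le ?_ (lintegral_mono_set (Set.Ioo_subset_Icc_self))
  rw [setLIntegral_pos_iff (by fun_prop)]
  refine lt_of_lt_of_le ?_ (measure_mono (s := Set.Ioo 0 Real.pi) ?_)
  · simp [hpi]
  · intro θ hθ
    refine ⟨?_, hθ⟩
    have := Real.sin_pos_of_mem_Ioo hθ
    have := angleConst_pos hα
    simp only [Function.mem_support, ne_eq, ENNReal.ofReal_eq_zero, not_le]
    positivity

/-- In the variables `z = (t cos θ, t sin θ)` the measure `t ^ (2α + 1) dt sin ^ (2α) θ dθ` becomes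
`z₂ ^ (2α) dz` on the upper half plane, and `coordShift x` becomes the distance from `z` to
`(x, 0)`. -/
lemma lintegral_coordShift_eq_half_plane {α : ℝ} (hα : -(1 / 2 : ℝ) < α) (x : ℝ)
    {h : ℝ → ℝ≥0∞} (hh : Measurable h) :
    ∫⁻ p, h (coordShift x p) ∂((coordMeasure (2 * α + 1)).prod (angleMeasure α)) =
      ∫⁻ z : ℝ × ℝ, ({z : ℝ × ℝ | 0 < z.2}.indicator (fun z =>
        ENNReal.ofReal (Real.Gamma (α + 1) / (Real.sqrt Real.pi * Real.Gamma (α + 1 / 2))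
          * z.2 ^ (2 * α)) * h (Real.sqrt ((z.1 - x) ^ 2 + z.2 ^ 2)))) z := by
  set K := Real.Gamma (α + 1) / (Real.sqrt Real.pi * Real.Gamma (α + 1 / 2)) with hK
  have hK0 : 0 < K := angleConst_pos hα
  have hpi := Real.pi_pos
  have hm : Measurable fun p => h (coordShift x p) := hh.comp (measurable_coordShift x)
  rw [← lintegral_comp_polarCoord_symm]
  rw [coordMeasure, angleMeasure, prod_withDensity (by fun_prop) (by fun_prop),
    lintegral_withDensity_eq_lintegral_mul _ (by fun_prop) hm,
    Measure.prod_restrict]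
  -- The boundary rays are null, and `(0, ∞) × (0, π)` is the part of the polar chart with `sin θ > 0`.
  have e1 : (Set.Ici (0 : ℝ) ×ˢ Set.Icc 0 Real.pi : Set (ℝ × ℝ)) =ᵐ[volume]
      Set.Ioi (0 : ℝ) ×ˢ Set.Ioo 0 Real.pi :=
    Measure.set_prod_ae_eq Ioi_ae_eq_Ici.symm Ioo_ae_eq_Icc.symm
  rw [← Measure.volume_eq_prod, setLIntegral_congr e1]
  have hsub : (Set.Ioi (0 : ℝ) ×ˢ Set.Ioo 0 Real.pi : Set (ℝ × ℝ)) ⊆ polarCoord.target := by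
    rintro ⟨t, θ⟩ ⟨ht, hθ⟩
    exact ⟨ht, by constructor <;> linarith [hθ.1, hθ.2, hpi]⟩
  rw [← Set.inter_eq_self_of_subset_left hsub, ← Measure.restrict_restrict
    (measurableSet_Ioi.prod measurableSet_Ioo), ← lintegral_indicator
    (measurableSet_Ioi.prod measurableSet_Ioo)]
  refine setLIntegral_congr_fun polarCoord.open_target.measurableSet ?_
  rintro ⟨t, θ⟩ ⟨ht, hθ⟩
  simp only [Set.mem_Ioi] at ht
  simp only [polarCoord_symm_apply, Set.indicator, Set.mem_prod, Set.mem_Ioi, ht, true_and,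
    Set.mem_Ioo, Set.mem_ofPred_eq, Pi.mul_apply, smul_eq_mul, mul_pos_iff_of_pos_left ht]
  by_cases hs : 0 < θ
  · have hs' : 0 < Real.sin θ := Real.sin_pos_of_mem_Ioo ⟨hs, hθ.2⟩
    rw [if_pos ⟨hs, hθ.2⟩, if_pos hs', ← mul_assoc, ← ENNReal.ofReal_mul (by positivity),
      ← ENNReal.ofReal_mul ht.le]
    congr 2
    · rw [Real.mul_rpow ht.le hs'.le, Real.rpow_add ht, Real.rpow_one]; ring
    · unfold coordShift
      congr 1
      simp only
      linear_combination (-t ^ 2) * Real.sin_sq_add_cos_sq θ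
  · have hs' : ¬ 0 < Real.sin θ :=
      not_lt.2 (Real.sin_nonpos_of_nonpos_of_neg_pi_le (not_lt.1 hs) hθ.1.le)
    rw [if_neg (fun h => hs h.1), if_neg hs', mul_zero]

/-- The half-plane density `z₂ ^ (2α)` does not change under horizontal translation, so the integral
does not depend on `x`; for `x = 0` it is a product. -/
lemma lintegral_coordShift {α : ℝ} (hα : -(1 / 2 : ℝ) < α) (x : ℝ)
    {h : ℝ → ℝ≥0∞} (hh : Measurable h) :
    ∫⁻ p, h (coordShift x p) ∂((coordMeasure (2 * α + 1)).prod (angleMeasure α)) =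
      angleMeasure α Set.univ * ∫⁻ r, h r ∂(coordMeasure (2 * α + 1)) := by
  have key : ∫⁻ p, h (coordShift x p) ∂((coordMeasure (2 * α + 1)).prod (angleMeasure α)) =
      ∫⁻ p, h (coordShift 0 p) ∂((coordMeasure (2 * α + 1)).prod (angleMeasure α)) := by
    rw [lintegral_coordShift_eq_half_plane hα x hh, lintegral_coordShift_eq_half_plane hα 0 hh,
      ← lintegral_add_right_eq_self _ ((x, 0) : ℝ × ℝ)]
    congr 1
    ext z
    simp [Set.indicator]
  have h0 : ∀ᵐ r ∂coordMeasure (2 * α + 1), 0 ≤ r :=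
    (withDensity_absolutelyContinuous _ _).ae_le (ae_restrict_mem measurableSet_Ici)
  have hm : Measurable fun p => h (coordShift 0 p) := hh.comp (measurable_coordShift 0)
  rw [key, lintegral_prod _ hm.aemeasurable]
  rw [← lintegral_const_mul _ hh]
  refine lintegral_congr_ae ?_
  filter_upwards [h0] with r hr
  simp [coordShift, Real.sqrt_sq hr, mul_comm]

lemma map_coordShift {α : ℝ} (hα : -(1 / 2 : ℝ) < α) (x : ℝ) :
    ((coordMeasure (2 * α + 1)).prod (angleMeasure α)).map (coordShift x) =
      angleMeasure α Set.univ • coordMeasure (2 * α + 1) := by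
  ext s hs
  have := lintegral_coordShift hα x (h := s.indicator 1) (measurable_one.indicator hs)
  rw [Measure.map_apply (measurable_coordShift x) hs, ← lintegral_indicator_one
    (measurable_coordShift x hs), Measure.smul_apply, smul_eq_mul, ← lintegral_indicator_one hs,
    ← this]
  rfl

/-! ### Bessel translation on the orthant -/

lemma lintegral_fin_prod_eq_prod {n : ℕ} (μ : Fin n → Measure ℝ) [∀ i, SigmaFinite (μ i)]
    {f : Fin n → ℝ → ℝ≥0∞} (hf : ∀ i, Measurable (f i)) :
    ∫⁻ x, ∏ i, f i (x i) ∂(Measure.pi μ) = ∏ i, ∫⁻ t, f i t ∂(μ i) := by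
  induction n with
  | zero => simp
  | succ n ih =>
    have hm : Measurable fun y : Fin n → ℝ => ∏ i, f i.succ (y i) :=
      Finset.measurable_prod _ fun i _ => (hf _).comp (measurable_pi_apply i)
    rw [Fin.prod_univ_succ, ← ih _ (fun i => hf i.succ),
      ← lintegral_prod_mul (hf 0).aemeasurable hm.aemeasurable,
      ← ((measurePreserving_piFinSuccAbove μ 0).symm).lintegral_comp_emb
        (MeasurableEquiv.measurableEmbedding _)]
    simp [MeasurableEquiv.piFinSuccAbove_symm_apply, Fin.insertNthEquiv, Fin.prod_univ_succ]

lemma pi_withDensity {n : ℕ} (μ : Fin n → Measure ℝ) [∀ i, SigmaFinite (μ i)]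
    {f : Fin n → ℝ → ℝ≥0∞} (hf : ∀ i, Measurable (f i))
    [∀ i, SigmaFinite ((μ i).withDensity (f i))] :
    Measure.pi (fun i => (μ i).withDensity (f i)) =
      (Measure.pi μ).withDensity (fun x => ∏ i, f i (x i)) := by
  refine Measure.pi_eq fun s hs => ?_
  rw [withDensity_apply _ (MeasurableSet.univ_pi hs), Measure.restrict_pi_pi,
    lintegral_fin_prod_eq_prod _ hf]
  simp_rw [withDensity_apply _ (hs _)]

lemma pi_smul {n : ℕ} (μ : Fin n → Measure ℝ) [∀ i, SigmaFinite (μ i)] (c : Fin n → ℝ≥0∞)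
    [∀ i, SigmaFinite (c i • μ i)] :
    Measure.pi (fun i => c i • μ i) = (∏ i, c i) • Measure.pi μ := by
  refine Measure.pi_eq fun s _ => ?_
  simp [Finset.prod_mul_distrib]

variable {n : ℕ} (α : Fin n → ℝ)

instance : SigmaFinite (lamA α) := by unfold lamA; infer_instance

lemma measurableSet_orthant (n : ℕ) : MeasurableSet (orthant n) := by
  have : orthant n = ⋂ i, {x | 0 ≤ x i} := by ext; simp [orthant]
  rw [this]
  exact MeasurableSet.iInter fun i => measurableSet_le measurable_const (by fun_prop)

lemma lamA_eq_map_pi : lamA α =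
    (Measure.pi fun i => coordMeasure (weight α i)).map (WithLp.toLp 2) := by
  have hd : Measurable fun x : EuclideanSpace ℝ (Fin n) =>
      ENNReal.ofReal (∏ i, x i ^ weight α i) :=
    (Finset.measurable_prod _ fun i _ => by fun_prop).ennreal_ofReal
  have hT := PiLp.volume_preserving_toLp (Fin n)
  have hpre : WithLp.toLp 2 ⁻¹' orthant n = Set.univ.pi fun _ : Fin n => Set.Ici (0 : ℝ) := by
    ext; simp [orthant, Pi.le_def]
  have hrp : (volume : Measure (Fin n → ℝ)).restrict (Set.univ.pi fun _ => Set.Ici 0) =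
      Measure.pi fun _ => volume.restrict (Set.Ici 0) := by
    rw [volume_pi, Measure.restrict_pi_pi]
  unfold coordMeasure
  rw [pi_withDensity _ (fun i => by fun_prop)]
  ext s hs
  rw [lamA, withDensity_apply _ hs, Measure.restrict_restrict hs,
    ← hT.setLIntegral_comp_preimage (hs.inter (measurableSet_orthant n)) hd,
    Measure.map_apply (by fun_prop) hs, withDensity_apply _ (hs.preimage (by fun_prop)),
    ← hrp, Measure.restrict_restrict (hs.preimage (by fun_prop)), Set.preimage_inter, hpre]
  refine setLIntegral_congr_fun
    ((hs.preimage (by fun_prop)).inter (.univ_pi fun _ => measurableSet_Ici)) fun x hx => ?_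
  exact ENNReal.ofReal_prod_of_nonneg fun i _ => Real.rpow_nonneg (hx.2 i trivial) _

/-- The product of the angular measures, on `[0, π]ⁿ`. -/
noncomputable def angles : Measure (Fin n → ℝ) := Measure.pi fun i => angleMeasure (α i)

lemma measurable_besselShift_uncurry :
    Measurable fun q : EuclideanSpace ℝ (Fin n) × EuclideanSpace ℝ (Fin n) × (Fin n → ℝ) =>
      besselShift q.1 q.2.1 q.2.2 := by
  unfold besselShift; fun_prop

lemma besselShift_comm (x t : EuclideanSpace ℝ (Fin n)) (θ : Fin n → ℝ) :
    besselShift x t θ = besselShift t x θ := by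
  unfold besselShift; congr; ext i; congr 1; ring

instance : SigmaFinite (angles α) := by unfold angles; infer_instance

variable {α}

lemma angles_univ_lt_top (hα : ∀ i, -(1 / 2 : ℝ) < α i) : angles α Set.univ < ∞ := by
  rw [angles, Measure.pi_univ]
  exact ENNReal.prod_lt_top fun i _ => angleMeasure_univ_lt_top (hα i)

lemma angles_univ_ne_zero (hα : ∀ i, -(1 / 2 : ℝ) < α i) : angles α Set.univ ≠ 0 := by
  rw [angles, Measure.pi_univ]
  exact Finset.prod_ne_zero_iff.2 fun i _ => angleMeasure_univ_pos (hα i)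

/-- For fixed `x` the shift carries `λ_a ⊗ angles` to a multiple of `λ_a`. Together
with the symmetry in `x` and `t` this gives the Hölder and Young inequalities. -/
lemma map_besselShift (hα : ∀ i, -(1 / 2 : ℝ) < α i) (x : EuclideanSpace ℝ (Fin n)) :
    ((lamA α).prod (angles α)).map (fun q => besselShift x q.1 q.2) =
      angles α Set.univ • lamA α := by
  have hs (i : Fin n) : SigmaFinite (angleMeasure (α i) Set.univ • coordMeasure (weight α i)) := by
    have := (ENNReal.coe_toNNReal (angleMeasure_univ_lt_top (hα i)).ne)
    rw [← this]
    exact inferInstanceAs (SigmaFinite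
      ((angleMeasure (α i) Set.univ).toNNReal • coordMeasure (weight α i)))
  have hs' (i : Fin n) : SigmaFinite (((coordMeasure (weight α i)).prod (angleMeasure (α i))).map
      (coordShift (x i))) := by
    rw [weight, map_coordShift (hα i)]; exact hs i
  have h1 : (Measure.pi fun i => (coordMeasure (weight α i)).prod (angleMeasure (α i))).map
      (fun q i => coordShift (x i) (q i)) =
      angles α Set.univ • Measure.pi fun i => coordMeasure (weight α i) := by
    rw [Measure.pi_map_pi fun i => (measurable_coordShift (x i)).aemeasurable]
    simp_rw [weight, map_coordShift (hα _)]
    rw [angles, Measure.pi_univ]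
    have := hs
    simp only [weight] at this
    exact pi_smul _ _
  have h2 := (measurePreserving_arrowProdEquivProdArrow ℝ ℝ (Fin n)
    (fun i => coordMeasure (weight α i)) (fun i => angleMeasure (α i))).map_eq
  have h3 : (lamA α).prod (angles α) =
      ((Measure.pi fun i => coordMeasure (weight α i)).prod (angles α)).map
        (Prod.map (WithLp.toLp 2) id) := by
    rw [lamA_eq_map_pi, ← Measure.map_prod_map _ _ (by fun_prop) measurable_id, Measure.map_id]
  have hS : Measurable fun q : EuclideanSpace ℝ (Fin n) × (Fin n → ℝ) =>
      besselShift x q.1 q.2 :=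
    measurable_besselShift_uncurry.comp (measurable_const.prodMk measurable_id)
  have hc : Measurable fun (q : Fin n → ℝ × ℝ) i => coordShift (x i) (q i) :=
    measurable_pi_lambda _ fun i => (measurable_coordShift _).comp (measurable_pi_apply i)
  rw [h3, angles, ← h2, Measure.map_map hS (by fun_prop), Measure.map_map (by fun_prop)
    (MeasurableEquiv.measurable _), lamA_eq_map_pi, ← Measure.map_smul, ← angles, ← h1,
    Measure.map_map (by fun_prop) hc]
  rfl

/-! ### Homogeneity of the weighted measure -/

/-- The homogeneity degree `n + |a|` of `λ_a` under dilations. -/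
noncomputable def homDim (α : Fin n → ℝ) : ℝ := n + ∑ i, weight α i

lemma homDim_pos (hn : 1 ≤ n) (hα : ∀ i, -(1 / 2 : ℝ) < α i) : 0 < homDim α := by
  have : 0 ≤ ∑ i, weight α i := Finset.sum_nonneg fun i _ => by unfold weight; linarith [hα i]
  have : (1 : ℝ) ≤ n := by exact_mod_cast hn
  unfold homDim; linarith

lemma map_smul_lamA (α : Fin n → ℝ) {c : ℝ} (hc : 0 < c) :
    (lamA α).map (c • ·) = ENNReal.ofReal (c ^ (-homDim α)) • lamA α := by
  ext s hs
  have hms : MeasurableSet (orthant n ∩ s) := (measurableSet_orthant n).inter hs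
  have hd : Measurable fun x : EuclideanSpace ℝ (Fin n) =>
      ENNReal.ofReal (∏ i, x i ^ weight α i) :=
    (Finset.measurable_prod _ fun i _ => by fun_prop).ennreal_ofReal
  have hpre : MeasurableSet ((c • · : EuclideanSpace ℝ (Fin n) → _) ⁻¹' s) :=
    hs.preimage (by fun_prop)
  set G : EuclideanSpace ℝ (Fin n) → ℝ≥0∞ :=
    (orthant n ∩ s).indicator fun x => ENNReal.ofReal (∏ i, x i ^ weight α i) with hG
  have hGm : Measurable G := hd.indicator hms
  have e2 : lamA α s = ∫⁻ x, G x := by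
    rw [lamA, withDensity_apply _ hs, Measure.restrict_restrict hs, Set.inter_comm,
      lintegral_indicator hms]
  have e1 : lamA α ((c • · : EuclideanSpace ℝ (Fin n) → _) ⁻¹' s) =
      ∫⁻ x, ENNReal.ofReal (c ^ (-∑ i, weight α i)) * G (c • x) := by
    rw [lamA, withDensity_apply _ hpre, Measure.restrict_restrict hpre,
      ← lintegral_indicator (hpre.inter (measurableSet_orthant n))]
    congr 1
    ext x
    have hmem : c • x ∈ orthant n ↔ x ∈ orthant n := by
      simp [orthant, hc]
    by_cases hx : x ∈ orthant n <;> by_cases hx' : c • x ∈ s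
    · have h1 : ∏ i, (c • x) i ^ weight α i = c ^ (∑ i, weight α i) * ∏ i, x i ^ weight α i := by
        simp only [PiLp.smul_apply, smul_eq_mul]
        simp_rw [fun i => Real.mul_rpow hc.le (hx i) (z := weight α i)]
        rw [Finset.prod_mul_distrib, Real.rpow_sum_of_pos hc]
      rw [hG, Set.indicator_of_mem (show x ∈ (c • ·) ⁻¹' s ∩ orthant n from ⟨hx', hx⟩),
        Set.indicator_of_mem (show c • x ∈ orthant n ∩ s from ⟨hmem.2 hx, hx'⟩), h1,
        ← ENNReal.ofReal_mul (by positivity), ← mul_assoc, ← Real.rpow_add hc]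
      simp
    · simp [hG, hx, hx']
    · simp [hG, hmem, hx, hx']
    · simp [hG, hmem, hx, hx']
  have e3 : ∫⁻ x, G (c • x) = ENNReal.ofReal (c ^ (-(n : ℝ))) * ∫⁻ x, G x := by
    rw [← lintegral_map hGm (measurable_const_smul c), Measure.map_addHaar_smul _ hc.ne',
      lintegral_smul_measure, smul_eq_mul]
    congr 2
    rw [abs_of_pos (by positivity), finrank_euclideanSpace, Fintype.card_fin, Real.rpow_neg hc.le,
      Real.rpow_natCast]
  have hGc : Measurable fun x => G (c • x) := hGm.comp (measurable_const_smul c)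
  rw [Measure.map_apply (measurable_const_smul c) hs, e1, lintegral_const_mul _ hGc, e3,
    Measure.smul_apply, smul_eq_mul, e2, ← mul_assoc,
    ← ENNReal.ofReal_mul (by positivity), ← Real.rpow_add hc]
  congr 3
  unfold homDim; ring

lemma lamA_preimage_smul (α : Fin n → ℝ) {c : ℝ} (hc : 0 < c)
    (s : Set (EuclideanSpace ℝ (Fin n))) (hs : MeasurableSet s) :
    lamA α ((c • ·) ⁻¹' s) = ENNReal.ofReal (c ^ (-homDim α)) * lamA α s := by
  rw [← Measure.map_apply (measurable_const_smul c) hs, map_smul_lamA α hc, Measure.smul_apply,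
    smul_eq_mul]

lemma lamA_closedBall (α : Fin n → ℝ) {r : ℝ} (hr : 0 < r) :
    lamA α (Metric.closedBall 0 r) =
      ENNReal.ofReal (r ^ homDim α) * lamA α (Metric.closedBall 0 1) := by
  have h := lamA_preimage_smul α (inv_pos.2 hr) (Metric.closedBall 0 1) measurableSet_closedBall
  have : (r⁻¹ • · : EuclideanSpace ℝ (Fin n) → _) ⁻¹' Metric.closedBall 0 1 =
      Metric.closedBall 0 r := by
    ext x
    simp [norm_smul, abs_of_pos hr, inv_mul_le_iff₀ hr]
  rw [this] at h
  rw [h, Real.inv_rpow hr.le, Real.rpow_neg hr.le, inv_inv]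

lemma lamA_closedBall_lt_top (hα : ∀ i, -(1 / 2 : ℝ) < α i) (r : ℝ) :
    lamA α (Metric.closedBall 0 r) < ∞ := by
  have h1 : lamA α (Metric.closedBall 0 1) < ∞ := by
    rw [lamA, withDensity_apply _ measurableSet_closedBall,
      Measure.restrict_restrict measurableSet_closedBall]
    calc _ ≤ ∫⁻ x in Metric.closedBall (0 : EuclideanSpace ℝ (Fin n)) 1 ∩ orthant n, 1 := by
          refine setLIntegral_mono measurable_const fun x hx => ?_
          refine ENNReal.ofReal_le_one.2 (Finset.prod_le_one
            (fun i _ => Real.rpow_nonneg (hx.2 i) _) fun i _ => ?_)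
          refine Real.rpow_le_one (hx.2 i) ?_ (by unfold weight; linarith [hα i])
          have h2 : ‖x‖ ≤ 1 := by simpa using hx.1
          exact ((Real.le_norm_self _).trans (PiLp.norm_apply_le x i)).trans h2
      _ ≤ volume (Metric.closedBall (0 : EuclideanSpace ℝ (Fin n)) 1) := by
          rw [lintegral_one, Measure.restrict_apply_univ]
          exact measure_mono Set.inter_subset_left
      _ < ∞ := measure_closedBall_lt_top
  have h2 : Metric.closedBall (0 : EuclideanSpace ℝ (Fin n)) r ⊆
      Metric.closedBall 0 (max r 1) := Metric.closedBall_subset_closedBall (le_max_left _ _)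
  refine (measure_mono h2).trans_lt ?_
  rw [lamA_closedBall α (by positivity)]
  exact ENNReal.mul_lt_top ENNReal.ofReal_lt_top h1

lemma lamA_singleton_zero (hn : 1 ≤ n) (α : Fin n → ℝ) : lamA α {0} = 0 := by
  have : Nonempty (Fin n) := ⟨⟨0, hn⟩⟩
  refine withDensity_absolutelyContinuous _ _ (Measure.restrict_le_self.absolutelyContinuous ?_)
  simp

lemma setLIntegral_Ioc_rpow {N r : ℝ} (hN : 0 < N) (hr : 0 ≤ r) :
    ∫⁻ t in Set.Ioc 0 r, ENNReal.ofReal (t ^ (N - 1)) = ENNReal.ofReal (r ^ N / N) := by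
  have hI : IntervalIntegrable (fun t : ℝ => t ^ (N - 1)) volume 0 r :=
    intervalIntegral.intervalIntegrable_rpow' (by linarith)
  rw [← ofReal_integral_eq_lintegral_ofReal hI.1, ← intervalIntegral.integral_of_le hr,
    integral_rpow (Or.inl (by linarith))]
  · simp [Real.zero_rpow hN.ne']
  · filter_upwards [ae_restrict_mem measurableSet_Ioc] with t ht using Real.rpow_nonneg ht.1.le _

/-- Polar decomposition of `λ_a` on the unit ball, without spherical measure: the two sides agree on
all half-lines by `lamA_closedBall`. -/
lemma map_norm_lamA_closedBall (hn : 1 ≤ n) (hα : ∀ i, -(1 / 2 : ℝ) < α i) :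
    ((lamA α).restrict (Metric.closedBall 0 1)).map norm =
      (lamA α (Metric.closedBall 0 1) * ENNReal.ofReal (homDim α)) •
        (volume.restrict (Set.Ioc 0 1)).withDensity
          fun t => ENNReal.ofReal (t ^ (homDim α - 1)) := by
  have hN := homDim_pos hn hα
  have : IsFiniteMeasure ((lamA α).restrict (Metric.closedBall 0 1)) :=
    ⟨by simpa using lamA_closedBall_lt_top hα 1⟩
  refine Measure.ext_of_Iic _ _ fun r => ?_
  rw [Measure.map_apply measurable_norm measurableSet_Iic, Measure.restrict_apply
    (measurableSet_Iic.preimage measurable_norm), Measure.smul_apply,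
    withDensity_apply _ measurableSet_Iic, Measure.restrict_restrict measurableSet_Iic,
    smul_eq_mul]
  have hpre : norm ⁻¹' Set.Iic r ∩ Metric.closedBall (0 : EuclideanSpace ℝ (Fin n)) 1 =
      Metric.closedBall 0 (min r 1) := by ext; simp
  have hIoc : Set.Iic r ∩ Set.Ioc 0 1 = Set.Ioc 0 (min r 1) := by
    ext t; simp only [Set.mem_inter_iff, Set.mem_Iic, Set.mem_Ioc, le_min_iff]; tauto
  rw [hpre, hIoc]
  rcases le_or_gt r 0 with hr | hr
  · have h0 : lamA α (Metric.closedBall 0 (min r 1)) = 0 := by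
      refine measure_mono_null ?_ (lamA_singleton_zero hn α)
      intro x hx
      have : ‖x‖ ≤ r := by
        have := mem_closedBall_zero_iff.1 hx
        exact this.trans (min_le_left _ _)
      exact norm_le_zero_iff.1 (this.trans hr)
    rw [h0, Set.Ioc_eq_empty (by simp [hr])]
    simp
  · have hm : 0 < min r 1 := lt_min hr one_pos
    rw [lamA_closedBall α hm, setLIntegral_Ioc_rpow hN hm.le, mul_assoc,
      ← ENNReal.ofReal_mul hN.le, mul_comm]
    congr 2
    field_simp

lemma setLIntegral_closedBall_radial (hn : 1 ≤ n) (hα : ∀ i, -(1 / 2 : ℝ) < α i)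
    {g : ℝ → ℝ≥0∞} (hg : Measurable g) :
    ∫⁻ x in Metric.closedBall 0 1, g ‖x‖ ∂lamA α =
      lamA α (Metric.closedBall 0 1) * ENNReal.ofReal (homDim α) *
        ∫⁻ t in Set.Ioo 0 1, g t * ENNReal.ofReal (t ^ (homDim α - 1)) := by
  rw [← lintegral_map hg measurable_norm, map_norm_lamA_closedBall hn hα, lintegral_smul_measure,
    lintegral_withDensity_eq_lintegral_mul _ (by fun_prop) hg, smul_eq_mul,
    setLIntegral_congr Ioo_ae_eq_Ioc]
  simp [mul_comm]

/-! ### Hölder and Young inequalities for the Bessel convolution -/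

lemma lintegral_comp_besselShift (hα : ∀ i, -(1 / 2 : ℝ) < α i) (x : EuclideanSpace ℝ (Fin n))
    {h : EuclideanSpace ℝ (Fin n) → ℝ≥0∞} (hh : Measurable h) :
    ∫⁻ q, h (besselShift x q.1 q.2) ∂((lamA α).prod (angles α)) =
      angles α Set.univ * ∫⁻ t, h t ∂lamA α := by
  have hS : Measurable fun q : EuclideanSpace ℝ (Fin n) × (Fin n → ℝ) =>
      besselShift x q.1 q.2 :=
    measurable_besselShift_uncurry.comp (measurable_const.prodMk measurable_id)
  rw [← lintegral_map hh hS, map_besselShift hα, lintegral_smul_measure, smul_eq_mul]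

lemma measurable_comp_besselShift {h : EuclideanSpace ℝ (Fin n) → ℝ≥0∞} (hh : Measurable h)
    (x : EuclideanSpace ℝ (Fin n)) :
    Measurable fun q : EuclideanSpace ℝ (Fin n) × (Fin n → ℝ) => h (besselShift x q.1 q.2) :=
  hh.comp (measurable_besselShift_uncurry.comp (measurable_const.prodMk measurable_id))

lemma measurable_besselTranslation {h : EuclideanSpace ℝ (Fin n) → ℝ≥0∞} (hh : Measurable h) :
    Measurable fun q : EuclideanSpace ℝ (Fin n) × EuclideanSpace ℝ (Fin n) =>
      besselTranslation α q.2 h q.1 := by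
  have : Measurable fun r : (EuclideanSpace ℝ (Fin n) × EuclideanSpace ℝ (Fin n)) × (Fin n → ℝ) =>
      h (besselShift r.1.1 r.1.2 r.2) :=
    hh.comp (measurable_besselShift_uncurry.comp (by fun_prop : Measurable fun
      r : (EuclideanSpace ℝ (Fin n) × EuclideanSpace ℝ (Fin n)) × (Fin n → ℝ) =>
        (r.1.1, r.1.2, r.2)))
  exact this.lintegral_prod_right' (ν := angles α)

lemma besselTranslation_comm (h : EuclideanSpace ℝ (Fin n) → ℝ≥0∞)
    (x t : EuclideanSpace ℝ (Fin n)) :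
    besselTranslation α t h x = besselTranslation α x h t := by
  simp only [besselTranslation, besselShift_comm x t]

lemma lintegral_besselTranslation (hα : ∀ i, -(1 / 2 : ℝ) < α i)
    (x : EuclideanSpace ℝ (Fin n)) {h : EuclideanSpace ℝ (Fin n) → ℝ≥0∞} (hh : Measurable h) :
    ∫⁻ t, besselTranslation α t h x ∂lamA α = angles α Set.univ * ∫⁻ t, h t ∂lamA α := by
  rw [← lintegral_comp_besselShift hα x hh,
    lintegral_prod _ (measurable_comp_besselShift hh x).aemeasurable]
  rfl

lemma besselConv_eq_lintegral_prod {κ f : EuclideanSpace ℝ (Fin n) → ℝ≥0∞} (hκ : Measurable κ)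
    (hf : AEMeasurable f (lamA α)) (x : EuclideanSpace ℝ (Fin n)) :
    besselConv α κ f x =
      ∫⁻ q, κ (besselShift x q.1 q.2) * f q.1 ∂((lamA α).prod (angles α)) := by
  have hm := measurable_comp_besselShift hκ x
  have hmf : AEMeasurable (fun q : EuclideanSpace ℝ (Fin n) × (Fin n → ℝ) =>
      κ (besselShift x q.1 q.2) * f q.1) ((lamA α).prod (angles α)) :=
    hm.aemeasurable.mul hf.comp_fst
  rw [lintegral_prod _ hmf, besselConv]
  refine lintegral_congr fun t => ?_
  exact (lintegral_mul_const _ (hm.comp measurable_prodMk_left)).symm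

lemma lintegral_comp_fst_prod_angles {f : EuclideanSpace ℝ (Fin n) → ℝ≥0∞}
    (hf : AEMeasurable f (lamA α)) :
    ∫⁻ q, f q.1 ∂((lamA α).prod (angles α)) = angles α Set.univ * ∫⁻ t, f t ∂lamA α := by
  rw [lintegral_prod _ hf.comp_fst]
  simp only [lintegral_const]
  rw [lintegral_mul_const'' _ hf, mul_comm]

lemma besselConv_le_holder (hα : ∀ i, -(1 / 2 : ℝ) < α i) {p p' : ℝ} (hpp : p'.HolderConjugate p)
    {κ f : EuclideanSpace ℝ (Fin n) → ℝ≥0∞} (hκ : Measurable κ)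
    (hf : AEMeasurable f (lamA α)) (x : EuclideanSpace ℝ (Fin n)) :
    besselConv α κ f x ≤ (angles α Set.univ * ∫⁻ t, κ t ^ p' ∂lamA α) ^ (1 / p') *
      (angles α Set.univ * ∫⁻ t, f t ^ p ∂lamA α) ^ (1 / p) := by
  rw [besselConv_eq_lintegral_prod hκ hf, ← lintegral_comp_besselShift hα x (hκ.pow_const p'),
    ← lintegral_comp_fst_prod_angles (hf.pow_const p)]
  exact ENNReal.lintegral_mul_le_Lp_mul_Lq _ hpp
    (measurable_comp_besselShift hκ x).aemeasurable hf.comp_fst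

lemma aemeasurable_besselConv {κ f : EuclideanSpace ℝ (Fin n) → ℝ≥0∞} (hκ : Measurable κ)
    (hf : AEMeasurable f (lamA α)) : AEMeasurable (besselConv α κ f) (lamA α) := by
  have h : AEMeasurable (fun q : EuclideanSpace ℝ (Fin n) × EuclideanSpace ℝ (Fin n) =>
      besselTranslation α q.2 κ q.1 * f q.2) ((lamA α).prod (lamA α)) :=
    (measurable_besselTranslation hκ).aemeasurable.mul hf.comp_snd
  exact h.lintegral_prod_right'

lemma lintegral_besselConv (hα : ∀ i, -(1 / 2 : ℝ) < α i)
    {κ f : EuclideanSpace ℝ (Fin n) → ℝ≥0∞} (hκ : Measurable κ) (hf : AEMeasurable f (lamA α)) :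
    ∫⁻ x, besselConv α κ f x ∂lamA α =
      angles α Set.univ * (∫⁻ t, κ t ∂lamA α) * ∫⁻ t, f t ∂lamA α := by
  have h : AEMeasurable (fun q : EuclideanSpace ℝ (Fin n) × EuclideanSpace ℝ (Fin n) =>
      besselTranslation α q.2 κ q.1 * f q.2) ((lamA α).prod (lamA α)) :=
    (measurable_besselTranslation hκ).aemeasurable.mul hf.comp_snd
  unfold besselConv
  rw [lintegral_lintegral_swap h, ← lintegral_const_mul'' _ hf]
  refine lintegral_congr fun t => ?_
  have ht : Measurable fun x => besselTranslation α t κ x :=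
    (measurable_besselTranslation hκ).comp measurable_prodMk_right
  rw [lintegral_mul_const _ ht]
  simp_rw [besselTranslation_comm κ _ t]
  rw [lintegral_besselTranslation hα t hκ]

/-- Hölder's inequality for the factorization `κ f = κ ^ (1/p') * (κ ^ (1/p) * f)`. -/
lemma besselConv_rpow_le (hα : ∀ i, -(1 / 2 : ℝ) < α i) {p p' : ℝ} (hpp : p'.HolderConjugate p)
    {κ f : EuclideanSpace ℝ (Fin n) → ℝ≥0∞} (hκ : Measurable κ)
    (hf : AEMeasurable f (lamA α)) (x : EuclideanSpace ℝ (Fin n)) :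
    besselConv α κ f x ^ p ≤ (angles α Set.univ * ∫⁻ t, κ t ∂lamA α) ^ (p / p') *
      besselConv α κ (fun t => f t ^ p) x := by
  have hk := (measurable_comp_besselShift hκ x).aemeasurable (μ := (lamA α).prod (angles α))
  have hp := hpp.symm.pos
  have hp' := hpp.pos
  have h1 := ENNReal.lintegral_mul_le_Lp_mul_Lq _ hpp (hk.pow_const (1 / p'))
    ((hk.pow_const (1 / p)).mul hf.comp_fst)
  rw [besselConv_eq_lintegral_prod hκ hf, besselConv_eq_lintegral_prod hκ (hf.pow_const p),
    ← lintegral_comp_besselShift hα x hκ]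
  have e0 : ∀ q : EuclideanSpace ℝ (Fin n) × (Fin n → ℝ), κ (besselShift x q.1 q.2) * f q.1 =
      κ (besselShift x q.1 q.2) ^ (1 / p') * (κ (besselShift x q.1 q.2) ^ (1 / p) * f q.1) := by
    intro q
    rw [← mul_assoc, ← ENNReal.rpow_add_of_nonneg _ _ (by positivity) (by positivity), one_div,
      one_div, hpp.inv_add_inv_eq_one, ENNReal.rpow_one]
  have e1 (a : ℝ≥0∞) : (a ^ (1 / p')) ^ p' = a := by
    rw [← ENNReal.rpow_mul, one_div_mul_cancel hp'.ne', ENNReal.rpow_one]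
  have e2 (a : ℝ≥0∞) : (a ^ (1 / p)) ^ p = a := by
    rw [← ENNReal.rpow_mul, one_div_mul_cancel hp.ne', ENNReal.rpow_one]
  simp only [Pi.mul_apply, ENNReal.mul_rpow_of_nonneg _ _ hp.le, e1, e2] at h1
  simp_rw [e0]
  refine (ENNReal.rpow_le_rpow h1 hp.le).trans_eq ?_
  rw [ENNReal.mul_rpow_of_nonneg _ _ hp.le, e2, ← ENNReal.rpow_mul]
  congr 2
  ring

/-- Young's inequality `‖κ *_a f‖_p ≤ C ‖κ‖₁ ‖f‖_p`. -/
lemma lintegral_besselConv_rpow_le (hα : ∀ i, -(1 / 2 : ℝ) < α i) {p p' : ℝ}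
    (hpp : p'.HolderConjugate p) {κ f : EuclideanSpace ℝ (Fin n) → ℝ≥0∞} (hκ : Measurable κ)
    (hf : AEMeasurable f (lamA α)) :
    ∫⁻ x, besselConv α κ f x ^ p ∂lamA α ≤
      (angles α Set.univ * ∫⁻ t, κ t ∂lamA α) ^ p * ∫⁻ t, f t ^ p ∂lamA α := by
  refine (lintegral_mono fun x => besselConv_rpow_le hα hpp hκ hf x).trans_eq ?_
  rw [lintegral_const_mul'' _ (aemeasurable_besselConv hκ (hf.pow_const p)),
    lintegral_besselConv hα hκ (hf.pow_const p), ← mul_assoc]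
  congr 1
  nth_rewrite 2 [← ENNReal.rpow_one (angles α Set.univ * ∫⁻ t, κ t ∂lamA α)]
  rw [← ENNReal.rpow_add_of_nonneg _ _ (div_nonneg hpp.symm.nonneg hpp.nonneg) zero_le_one]
  congr 1
  have h := hpp.inv_add_inv_eq_one
  have := hpp.symm.ne_zero
  have := hpp.ne_zero
  field_simp at h ⊢
  linarith

/-! ### Capacity -/

/-- Test functions may take the value `∞`: if the `p`-th power integral is finite, such a function
agrees almost everywhere with its real-valued version. -/
lemma capacity_le {p : ℝ} (hp : 0 < p) {κ f : EuclideanSpace ℝ (Fin n) → ℝ≥0∞}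
    {E : Set (EuclideanSpace ℝ (Fin n))} (hf : AEMeasurable f (lamA α))
    (h : ∀ x ∈ E, 1 ≤ besselConv α κ f x) :
    capacity α p κ E ≤ ∫⁻ t, f t ^ p ∂lamA α := by
  by_cases hfin : ∫⁻ t, f t ^ p ∂lamA α = ∞
  · simp [hfin]
  have hp0 : ENNReal.ofReal p ≠ 0 := by simpa using hp
  have hae : ∀ᵐ t ∂lamA α, ENNReal.ofReal (f t).toReal = f t := by
    filter_upwards [ae_lt_top' (hf.pow_const p) hfin] with t ht
    exact ENNReal.ofReal_toReal fun h => by simp [h, hp] at ht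
  have hnorm : eLpNorm (fun t => (f t).toReal) (ENNReal.ofReal p) (lamA α) ^ p =
      ∫⁻ t, f t ^ p ∂lamA α := by
    rw [eLpNorm_eq_lintegral_rpow_enorm_toReal hp0 ENNReal.ofReal_ne_top,
      ENNReal.toReal_ofReal hp.le, ← ENNReal.rpow_mul, one_div_mul_cancel hp.ne',
      ENNReal.rpow_one]
    refine lintegral_congr_ae ?_
    filter_upwards [hae] with t ht
    rw [Real.enorm_of_nonneg ENNReal.toReal_nonneg, ht]
  refine sInf_le ⟨fun t => (f t).toReal, ⟨hf.ennreal_toReal.aestronglyMeasurable, ?_⟩,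
    fun _ => ENNReal.toReal_nonneg, fun x hx => (h x hx).trans_eq ?_, hnorm.symm⟩
  · by_contra hc
    rw [not_lt, top_le_iff] at hc
    rw [hc, ENNReal.top_rpow_of_pos hp] at hnorm
    exact hfin hnorm.symm
  · refine lintegral_congr_ae ?_
    filter_upwards [hae] with t ht
    rw [ht]

lemma exists_of_capacity_lt {p : ℝ} (hp : 0 < p) {κ : EuclideanSpace ℝ (Fin n) → ℝ≥0∞}
    {E : Set (EuclideanSpace ℝ (Fin n))} {c : ℝ≥0∞} (h : capacity α p κ E < c) :
    ∃ f : EuclideanSpace ℝ (Fin n) → ℝ≥0∞, AEMeasurable f (lamA α) ∧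
      (∀ x ∈ E, 1 ≤ besselConv α κ f x) ∧ ∫⁻ t, f t ^ p ∂lamA α < c := by
  obtain ⟨_, ⟨f, hf, hf0, hE, rfl⟩, hc⟩ := sInf_lt_iff.1 h
  refine ⟨fun t => ENNReal.ofReal (f t), hf.1.aemeasurable.ennreal_ofReal, hE, ?_⟩
  convert hc using 1
  have hp0 : ENNReal.ofReal p ≠ 0 := by simpa using hp
  rw [eLpNorm_eq_lintegral_rpow_enorm_toReal hp0 ENNReal.ofReal_ne_top,
    ENNReal.toReal_ofReal hp.le, ← ENNReal.rpow_mul, one_div_mul_cancel hp.ne',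
    ENNReal.rpow_one]
  simp_rw [Real.enorm_of_nonneg (hf0 _)]

lemma capacity_mono {p : ℝ} {κ : EuclideanSpace ℝ (Fin n) → ℝ≥0∞}
    {E F : Set (EuclideanSpace ℝ (Fin n))} (h : E ⊆ F) : capacity α p κ E ≤ capacity α p κ F :=
  sInf_le_sInf fun _ ⟨f, hf, hf0, hF, hc⟩ => ⟨f, hf, hf0, fun x hx => hF x (h hx), hc⟩

/-- The supremum of the test functions of the pieces is a test function of the union, and the `p`-th
power of a supremum is at most the sum of the `p`-th powers. -/
lemma capacity_iUnion_eq_zero {p : ℝ} (hp : 0 < p) {κ : EuclideanSpace ℝ (Fin n) → ℝ≥0∞}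
    {E : ℕ → Set (EuclideanSpace ℝ (Fin n))} (h : ∀ k, capacity α p κ (E k) = 0) :
    capacity α p κ (⋃ k, E k) = 0 := by
  refine le_antisymm (le_of_forall_gt fun ε hε => ?_) zero_le
  obtain ⟨δ, hδ, hsum⟩ := ENNReal.exists_pos_sum_of_countable' hε.ne' ℕ
  choose f hf hE hlt using fun k => exists_of_capacity_lt hp ((h k).trans_lt (hδ k))
  refine lt_of_le_of_lt (capacity_le hp (f := fun t => ⨆ k, f k t) (.iSup hf) ?_)
    (lt_of_le_of_lt ?_ hsum)
  · intro x hx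
    obtain ⟨k, hk⟩ := Set.mem_iUnion.1 hx
    exact (hE k x hk).trans (lintegral_mono fun t => by gcongr; exact le_iSup (fun k => f k t) k)
  · calc ∫⁻ t, (⨆ k, f k t) ^ p ∂lamA α ≤ ∫⁻ t, ∑' k, f k t ^ p ∂lamA α := by
          refine lintegral_mono fun t => ?_
          rw [← ENNReal.orderIsoRpow_apply p hp, OrderIso.map_iSup]
          exact iSup_le fun k => ENNReal.le_tsum k
      _ = ∑' k, ∫⁻ t, f k t ^ p ∂lamA α := lintegral_tsum fun k => (hf k).pow_const p
      _ ≤ ∑' k, δ k := ENNReal.tsum_le_tsum fun k => (hlt k).le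

/-- The profile of a kernel may be extended to a nonincreasing function on all of `ℝ`. -/
lemma IsRadiallyDecreasingKernel.exists_antitone {κ : EuclideanSpace ℝ (Fin n) → ℝ≥0∞}
    (hκ : IsRadiallyDecreasingKernel α κ) :
    ∃ g : ℝ → ℝ≥0∞, Antitone g ∧
      (∫⁻ t in Set.Ioo (0 : ℝ) 1, g t * ENNReal.ofReal (t ^ (homDim α - 1))) < ∞ ∧
      ∀ x, κ x = g ‖x‖ := by
  obtain ⟨g, hg, -, hint, hx⟩ := hκ
  refine ⟨fun t => g (max t 0), fun s t hst => hg (Set.mem_Ici.2 (le_max_right _ _))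
    (Set.mem_Ici.2 (le_max_right _ _)) (max_le_max_right _ hst), ?_,
    fun x => by simp only [hx, max_eq_left (norm_nonneg x)]⟩
  convert hint using 1
  refine setLIntegral_congr_fun measurableSet_Ioo fun t ht => ?_
  simp only [max_eq_left ht.1.le, homDim]

lemma apply_one_lt_top {N : ℝ} (hN : 0 < N) {g : ℝ → ℝ≥0∞} (hg : Antitone g)
    (h : (∫⁻ t in Set.Ioo (0 : ℝ) 1, g t * ENNReal.ofReal (t ^ (N - 1))) < ∞) : g 1 < ∞ := by
  have h1 : g 1 * ENNReal.ofReal (1 / N) ≤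
      ∫⁻ t in Set.Ioo (0 : ℝ) 1, g t * ENNReal.ofReal (t ^ (N - 1)) := by
    have := setLIntegral_Ioc_rpow hN zero_le_one
    rw [Real.one_rpow] at this
    rw [← this, ← setLIntegral_congr Ioo_ae_eq_Ioc, ← lintegral_const_mul _ (by fun_prop)]
    refine setLIntegral_mono' measurableSet_Ioo fun t ht => ?_
    gcongr
    exact hg ht.2.le
  by_contra hc
  rw [not_lt, top_le_iff] at hc
  rw [hc, ENNReal.top_mul (by simpa using hN)] at h1
  exact (h1.trans_lt h).ne rfl

lemma setLIntegral_orthant_diff (α : Fin n → ℝ) (f : EuclideanSpace ℝ (Fin n) → ℝ≥0∞) :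
    ∫⁻ x in orthant n \ Metric.ball 0 1, f x ∂lamA α =
      ∫⁻ x in (Metric.ball 0 1)ᶜ, f x ∂lamA α := by
  have h : ∀ᵐ x ∂lamA α, x ∈ orthant n :=
    (withDensity_absolutelyContinuous _ _).ae_le (ae_restrict_mem (measurableSet_orthant n))
  refine setLIntegral_congr ?_
  filter_upwards [h] with x hx
  exact propext ⟨fun h => h.2, fun h => ⟨hx, h⟩⟩

lemma norm_besselShift_le (x t : EuclideanSpace ℝ (Fin n)) (θ : Fin n → ℝ) :
    ‖besselShift x t θ‖ ≤ ‖x‖ + ‖t‖ := by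
  set a : EuclideanSpace ℝ (Fin n) → EuclideanSpace ℝ (Fin n) :=
    fun x => WithLp.toLp 2 fun i => |x i| with ha
  have hnorm (x) : ‖a x‖ = ‖x‖ := by simp [EuclideanSpace.norm_eq, ha]
  rw [← hnorm x, ← hnorm t]
  refine le_trans ?_ (norm_add_le (a x) (a t))
  rw [EuclideanSpace.norm_eq, EuclideanSpace.norm_eq]
  gcongr with i
  have h1 : ‖besselShift x t θ i‖ =
      √(x i ^ 2 + t i ^ 2 - 2 * x i * t i * Real.cos (θ i)) := abs_of_nonneg (Real.sqrt_nonneg _)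
  have h2 : ‖(a x + a t) i‖ = |x i| + |t i| := abs_of_nonneg (by simp [ha]; positivity)
  rw [h1, h2]
  refine Real.sqrt_le_iff.2 ⟨by positivity, ?_⟩
  have h3 : |x i * t i * Real.cos (θ i)| ≤ |x i| * |t i| := by
    rw [abs_mul, abs_mul]
    exact mul_le_of_le_one_right (by positivity) (Real.abs_cos_le_one _)
  nlinarith [neg_abs_le (x i * t i * Real.cos (θ i)), sq_abs (x i), sq_abs (t i)]

lemma tendsto_const_mul_rpow_nhdsGT_zero {C M : ℝ≥0∞} (hC : C ≠ ∞) (hM : M ≠ ∞) {s : ℝ}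
    (hs : 0 < s) :
    Filter.Tendsto (fun ε : ℝ≥0∞ => C * (M * ε) ^ s) (nhdsWithin 0 (Set.Ioi 0)) (nhds 0) := by
  have h1 : Filter.Tendsto (fun ε : ℝ≥0∞ => M * ε) (nhds 0) (nhds (M * 0)) :=
    ENNReal.Tendsto.const_mul Filter.tendsto_id (Or.inr hM)
  have h2 := ENNReal.Tendsto.const_mul (a := C) (h1.ennrpow_const s) (Or.inr hC)
  simp only [mul_zero, ENNReal.zero_rpow_of_pos hs] at h2
  exact h2.mono_left nhdsWithin_le_nhds

/-- By Hölder's inequality a test function for a point cannot have small norm. -/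
lemma capacity_singleton_pos (hα : ∀ i, -(1 / 2 : ℝ) < α i) {p p' : ℝ}
    (hpp : p'.HolderConjugate p) {κ : EuclideanSpace ℝ (Fin n) → ℝ≥0∞} (hκ : Measurable κ)
    (h : ∫⁻ t, κ t ^ p' ∂lamA α < ∞) (y : EuclideanSpace ℝ (Fin n)) :
    0 < capacity α p κ {y} := by
  have hp := hpp.symm.pos
  have hM := angles_univ_lt_top hα
  set C := (angles α Set.univ * ∫⁻ t, κ t ^ p' ∂lamA α) ^ (1 / p') with hC
  have hCfin : C ≠ ∞ :=
    ENNReal.rpow_ne_top_of_nonneg (one_div_nonneg.2 hpp.nonneg) (ENNReal.mul_lt_top hM h).ne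
  rw [pos_iff_ne_zero]
  intro h0
  have hlim := tendsto_const_mul_rpow_nhdsGT_zero hCfin hM.ne (one_div_pos.2 hp)
  obtain ⟨ε, hε, hε0⟩ := ((hlim.eventually_lt_const one_pos).and self_mem_nhdsWithin).exists
  obtain ⟨f, hf, hE, hlt⟩ := exists_of_capacity_lt hp (h0.trans_lt hε0)
  have := (hE y rfl).trans (besselConv_le_holder hα hpp hκ hf y)
  refine absurd (this.trans_lt (lt_of_le_of_lt ?_ hε)) (lt_irrefl _)
  gcongr

/-! ### Kernels with large tails -/

/-- If `h ^ p'` has infinite integral, there are functions of arbitrarily small `L^p` norm whose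
pairing with `h` is at least one. -/
lemma exists_lintegral_mul_ge_one {X : Type*} [MeasurableSpace X] {μ : Measure X} {p p' : ℝ}
    (hpp : p'.HolderConjugate p) {h : X → ℝ≥0∞} (hh : Measurable h) {A : ℕ → Set X}
    (hA : ∀ m, MeasurableSet (A m)) (hmono : Monotone A)
    (hfin : ∀ m, ∫⁻ x in A m, h x ^ p' ∂μ < ∞) (htop : ∫⁻ x in ⋃ m, A m, h x ^ p' ∂μ = ∞)
    {ε : ℝ≥0∞} (hε : ε ≠ 0) :
    ∃ f : X → ℝ≥0∞, Measurable f ∧ (∀ x ∉ ⋃ m, A m, f x = 0) ∧ 1 ≤ ∫⁻ x, h x * f x ∂μ ∧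
      ∫⁻ x, f x ^ p ∂μ ≤ ε := by
  have hp := hpp.symm.pos
  have hp1 : 0 < p - 1 := hpp.symm.sub_one_pos
  have hp1' : 0 < p' - 1 := hpp.sub_one_pos
  have hsup : ⨆ m, ∫⁻ x in A m, h x ^ p' ∂μ = ∞ := by
    rw [← htop, setLIntegral_iUnion_of_directed _ hmono.directed_le]
  have hc : (ε⁻¹) ^ (1 / (p - 1)) < ∞ :=
    ENNReal.rpow_lt_top_of_nonneg (by positivity) (by simpa using hε)
  obtain ⟨m, hm⟩ := lt_iSup_iff.1 (hsup ▸ hc)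
  set I := ∫⁻ x in A m, h x ^ p' ∂μ with hI
  have hI0 : I ≠ 0 := hm.ne_bot
  have hIt : I ≠ ∞ := (hfin m).ne
  -- The equality case of Hölder on `A m`: the pairing is `I⁻¹ * I = 1`, and the `p`-th power
  -- integral is `I ^ (1 - p)`, small once `I` is large.
  refine ⟨(A m).indicator fun x => I⁻¹ * h x ^ (p' - 1),
    ((hh.pow_const _).const_mul _).indicator (hA m), fun x hx => ?_, ?_, ?_⟩
  · exact Set.indicator_of_notMem (fun h => hx (Set.mem_iUnion_of_mem m h)) _
  · have e : ∀ x, h x * (A m).indicator (fun x => I⁻¹ * h x ^ (p' - 1)) x =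
        (A m).indicator (fun x => I⁻¹ * h x ^ p') x := by
      intro x
      by_cases hx : x ∈ A m
      · rw [Set.indicator_of_mem hx, Set.indicator_of_mem hx, mul_left_comm]
        congr 1
        nth_rewrite 1 [← ENNReal.rpow_one (h x)]
        rw [← ENNReal.rpow_add_of_nonneg _ _ zero_le_one hp1'.le]
        congr 1; ring
      · simp [hx]
    simp_rw [e]
    rw [lintegral_indicator (hA m), lintegral_const_mul _ (hh.pow_const _), ← hI,
      ENNReal.inv_mul_cancel hI0 hIt]
  · have e : ∀ x, (A m).indicator (fun x => I⁻¹ * h x ^ (p' - 1)) x ^ p =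
        (A m).indicator (fun x => I⁻¹ ^ p * h x ^ p') x := by
      intro x
      by_cases hx : x ∈ A m
      · rw [Set.indicator_of_mem hx, Set.indicator_of_mem hx,
          ENNReal.mul_rpow_of_nonneg _ _ hp.le, ← ENNReal.rpow_mul, hpp.sub_one_mul_conj]
      · simp [hx, hp]
    simp_rw [e]
    rw [lintegral_indicator (hA m), lintegral_const_mul _ (hh.pow_const _), ← hI]
    have h1 : I⁻¹ ^ p * I = (I ^ (p - 1))⁻¹ := by
      rw [ENNReal.rpow_sub _ _ hI0 hIt, ENNReal.rpow_one, ENNReal.inv_rpow, ENNReal.inv_div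
        (Or.inl hIt) (Or.inl hI0), div_eq_mul_inv, mul_comm]
    rw [h1, ENNReal.inv_le_iff_inv_le]
    calc ε⁻¹ = (ε⁻¹ ^ (1 / (p - 1))) ^ (p - 1) := by
          rw [← ENNReal.rpow_mul, one_div_mul_cancel hp1.ne', ENNReal.rpow_one]
      _ ≤ I ^ (p - 1) := ENNReal.rpow_le_rpow hm.le hp1.le

/-- For `‖x‖ ≤ R ≤ ‖t‖` the shifted point has norm at most `2 ‖t‖`, so the translated kernel is at
least a constant times `g (2 ‖t‖)`, which still has infinite `L^{p'}` norm outside every ball. -/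
lemma capacity_closedBall_eq_zero (hα : ∀ i, -(1 / 2 : ℝ) < α i) {p p' : ℝ}
    (hpp : p'.HolderConjugate p) {g : ℝ → ℝ≥0∞} (hg : Antitone g) (hg1 : g 1 < ∞)
    (h : ∫⁻ x in (Metric.ball 0 1)ᶜ, g ‖x‖ ^ p' ∂lamA α = ∞) {R : ℝ} (hR : 1 ≤ R) :
    capacity α p (fun x => g ‖x‖) (Metric.closedBall 0 R) = 0 := by
  have hp' := hpp.pos
  set M := angles α Set.univ with hM
  have hM0 : M ≠ 0 := angles_univ_ne_zero hα
  have hMt : M < ∞ := angles_univ_lt_top hα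
  have hgm : Measurable g := hg.measurable
  have hgp : Measurable fun x : EuclideanSpace ℝ (Fin n) => g ‖x‖ ^ p' :=
    (hgm.comp measurable_norm).pow_const p'
  set A : ℕ → Set (EuclideanSpace ℝ (Fin n)) :=
    fun m => (Metric.ball 0 R)ᶜ ∩ Metric.closedBall 0 m with hA
  have hAm (m : ℕ) : MeasurableSet (A m) := measurableSet_ball.compl.inter measurableSet_closedBall
  have hmono : Monotone A := fun m k hmk =>
    Set.inter_subset_inter_right _ (Metric.closedBall_subset_closedBall (by exact_mod_cast hmk))
  have hU : ⋃ m, A m = (Metric.ball 0 R)ᶜ := by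
    rw [hA, ← Set.inter_iUnion, Metric.iUnion_closedBall_nat, Set.inter_univ]
  set k : EuclideanSpace ℝ (Fin n) → ℝ≥0∞ := fun t => M * g (2 * ‖t‖) with hk
  have hkm : Measurable k := (hgm.comp (measurable_norm.const_mul 2)).const_mul M
  have hkp (t) : k t ^ p' = M ^ p' * g ‖(2 : ℝ) • t‖ ^ p' := by
    rw [hk, ENNReal.mul_rpow_of_nonneg _ _ hp'.le, norm_smul, Real.norm_two]
  have hfin (m : ℕ) : ∫⁻ x in A m, k x ^ p' ∂lamA α < ∞ := by
    calc ∫⁻ x in A m, k x ^ p' ∂lamA α ≤ ∫⁻ x in A m, (M * g 1) ^ p' ∂lamA α := by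
          refine setLIntegral_mono measurable_const fun x hx => ?_
          have : R ≤ ‖x‖ := by simpa using hx.1
          have := hg (show 1 ≤ 2 * ‖x‖ by linarith)
          simp only [hk]
          gcongr
      _ = (M * g 1) ^ p' * lamA α (A m) := by
          rw [lintegral_const, Measure.restrict_apply_univ]
      _ < ∞ := ENNReal.mul_lt_top
          (ENNReal.rpow_lt_top_of_nonneg hp'.le (ENNReal.mul_lt_top hMt hg1).ne)
          ((measure_mono Set.inter_subset_right).trans_lt (lamA_closedBall_lt_top hα m))
  -- On an annulus `g` is bounded by `g 1` and `λ_a` is finite, so all the mass lies at infinity.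
  have hfar : ∫⁻ x in (Metric.ball 0 (2 * R))ᶜ, g ‖x‖ ^ p' ∂lamA α = ∞ := by
    have hsub : (Metric.ball (0 : EuclideanSpace ℝ (Fin n)) 1)ᶜ ⊆
        (Metric.ball 0 (2 * R))ᶜ ∪ ((Metric.ball 0 1)ᶜ ∩ Metric.closedBall 0 (2 * R)) := by
      intro x hx
      by_cases hx' : x ∈ Metric.ball 0 (2 * R)
      · exact Or.inr ⟨hx, Metric.ball_subset_closedBall hx'⟩
      · exact Or.inl hx'
    have hnear : ∫⁻ x in (Metric.ball 0 1)ᶜ ∩ Metric.closedBall 0 (2 * R), g ‖x‖ ^ p' ∂lamA α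
        < ∞ := by
      calc _ ≤ ∫⁻ x in (Metric.ball (0 : EuclideanSpace ℝ (Fin n)) 1)ᶜ ∩
              Metric.closedBall 0 (2 * R), g 1 ^ p' ∂lamA α := by
            refine setLIntegral_mono measurable_const fun x hx => ?_
            have : 1 ≤ ‖x‖ := by simpa using hx.1
            gcongr
            exact hg this
        _ = g 1 ^ p' * lamA α ((Metric.ball 0 1)ᶜ ∩ Metric.closedBall 0 (2 * R)) := by
            rw [lintegral_const, Measure.restrict_apply_univ]
        _ < ∞ := ENNReal.mul_lt_top (ENNReal.rpow_lt_top_of_nonneg hp'.le hg1.ne)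
            ((measure_mono Set.inter_subset_right).trans_lt (lamA_closedBall_lt_top hα _))
    have := (lintegral_mono_set (f := fun x => g ‖x‖ ^ p') hsub (μ := lamA α)).trans
      (lintegral_union_le _ _ _)
    rw [h, top_le_iff, ENNReal.add_eq_top] at this
    exact this.resolve_right hnear.ne
  -- Dilation by two turns the integral of `k ^ p'` into the previous one.
  have htop : ∫⁻ x in ⋃ m, A m, k x ^ p' ∂lamA α = ∞ := by
    have hpre : (Metric.ball (0 : EuclideanSpace ℝ (Fin n)) R)ᶜ =
        ((2 : ℝ) • ·) ⁻¹' (Metric.ball 0 (2 * R))ᶜ := by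
      ext x; simp [norm_smul]
    have hg2 : Measurable fun x : EuclideanSpace ℝ (Fin n) => g ‖(2 : ℝ) • x‖ ^ p' :=
      hgp.comp (measurable_const_smul 2)
    simp_rw [hU, hkp]
    rw [lintegral_const_mul _ hg2, hpre,
      ← setLIntegral_map measurableSet_ball.compl hgp (measurable_const_smul 2),
      map_smul_lamA α two_pos, setLIntegral_smul_measure, hfar, smul_eq_mul, ENNReal.mul_top,
      ENNReal.mul_top]
    · simp [hM0, hMt.ne]
    · simpa using by positivity
  refine le_antisymm (ENNReal.le_of_forall_pos_le_add fun ε hε _ => ?_) zero_le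
  rw [zero_add]
  obtain ⟨f, hf, hf0, hkf, hfp⟩ := exists_lintegral_mul_ge_one hpp hkm hAm hmono hfin htop
    (ENNReal.coe_ne_zero.2 hε.ne')
  refine (capacity_le hpp.symm.pos hf.aemeasurable fun x hx => hkf.trans ?_).trans hfp
  refine lintegral_mono fun t => ?_
  by_cases ht : t ∈ ⋃ m, A m
  · rw [hU] at ht
    have ht' : R ≤ ‖t‖ := by simpa using ht
    have hx' : ‖x‖ ≤ R := by simpa using hx
    gcongr
    calc M * g (2 * ‖t‖) = ∫⁻ _, g (2 * ‖t‖) ∂angles α := by rw [lintegral_const, mul_comm]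
      _ ≤ besselTranslation α t (fun x => g ‖x‖) x :=
          lintegral_mono fun θ => hg ((norm_besselShift_le x t θ).trans (by linarith))
  · simp [hf0 t ht]

/-! ### Sets of capacity zero -/

lemma besselConv_add_left {κ₁ κ₂ f : EuclideanSpace ℝ (Fin n) → ℝ≥0∞} (h₁ : Measurable κ₁)
    (h₂ : Measurable κ₂) (hf : AEMeasurable f (lamA α)) (x : EuclideanSpace ℝ (Fin n)) :
    besselConv α (κ₁ + κ₂) f x = besselConv α κ₁ f x + besselConv α κ₂ f x := by
  rw [besselConv_eq_lintegral_prod (h₁.add h₂) hf, besselConv_eq_lintegral_prod h₁ hf,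
    besselConv_eq_lintegral_prod h₂ hf, ← lintegral_add_left']
  · simp_rw [Pi.add_apply, add_mul]
  · exact (measurable_comp_besselShift h₁ x).aemeasurable.mul hf.comp_fst

/-- If `κ₁` is integrable and `κ₂` is in `L^{p'}`, sets of capacity zero are null: for a test
function `f` of small norm, `κ₂ *_a f ≤ 1/2` everywhere by Hölder, so `κ₁ *_a f ≥ 1/2` on the set,
and Young's inequality with Chebyshev's bounds the measure of the set. -/
lemma lamA_eq_zero_of_capacity_eq_zero (hα : ∀ i, -(1 / 2 : ℝ) < α i) {p p' : ℝ}
    (hpp : p'.HolderConjugate p) {κ₁ κ₂ : EuclideanSpace ℝ (Fin n) → ℝ≥0∞} (h₁ : Measurable κ₁)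
    (h₂ : Measurable κ₂) (hi₁ : ∫⁻ x, κ₁ x ∂lamA α < ∞) (hi₂ : ∫⁻ x, κ₂ x ^ p' ∂lamA α < ∞)
    {E : Set (EuclideanSpace ℝ (Fin n))} (hE : capacity α p (κ₁ + κ₂) E = 0) :
    lamA α E = 0 := by
  have hp := hpp.symm.pos
  have hM := angles_univ_lt_top hα
  set C := (angles α Set.univ * ∫⁻ t, κ₂ t ^ p' ∂lamA α) ^ (1 / p') with hC
  have hCfin : C ≠ ∞ :=
    ENNReal.rpow_ne_top_of_nonneg (one_div_nonneg.2 hpp.nonneg) (ENNReal.mul_lt_top hM hi₂).ne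
  set B := (angles α Set.univ * ∫⁻ t, κ₁ t ∂lamA α) ^ p / 2⁻¹ ^ p with hB
  have hBfin : B ≠ ∞ := by
    refine ENNReal.div_ne_top
      (ENNReal.rpow_ne_top_of_nonneg hp.le (ENNReal.mul_lt_top hM hi₁).ne) ?_
    simp [ENNReal.rpow_eq_zero_iff]
  have hlim := tendsto_const_mul_rpow_nhdsGT_zero hCfin hM.ne (one_div_pos.2 hp)
  have hlim' := tendsto_const_mul_rpow_nhdsGT_zero hBfin ENNReal.one_ne_top one_pos
  simp only [one_mul, ENNReal.rpow_one] at hlim'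
  refine le_antisymm (ge_of_tendsto hlim' ?_) zero_le
  have h2 : (0 : ℝ≥0∞) < 2⁻¹ := by simp
  filter_upwards [hlim.eventually_lt_const h2, self_mem_nhdsWithin] with ε hε hε0
  obtain ⟨f, hf, hfE, hlt⟩ := exists_of_capacity_lt hp (hE.trans_lt hε0)
  have hsub : E ⊆ {x | 2⁻¹ ^ p ≤ besselConv α κ₁ f x ^ p} := by
    intro x hx
    have h3 := hfE x hx
    rw [besselConv_add_left h₁ h₂ hf] at h3
    have h4 : besselConv α κ₂ f x ≤ 2⁻¹ := by
      refine (besselConv_le_holder hα hpp h₂ hf x).trans (le_trans ?_ hε.le)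
      gcongr
    refine ENNReal.rpow_le_rpow ?_ hp.le
    by_contra h5
    have := ENNReal.add_lt_add_of_lt_of_le (by simpa using ne_top_of_le_ne_top (by simp) h4)
      (not_le.1 h5) h4
    rw [ENNReal.inv_two_add_inv_two] at this
    exact absurd h3 (not_le.2 this)
  calc lamA α E ≤ _ := measure_mono hsub
    _ ≤ (∫⁻ x, besselConv α κ₁ f x ^ p ∂lamA α) / 2⁻¹ ^ p :=
        meas_ge_le_lintegral_div ((aemeasurable_besselConv h₁ hf).pow_const p)
          (by simp [ENNReal.rpow_eq_zero_iff]) (by simp [ENNReal.rpow_eq_top_iff])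
    _ ≤ ((angles α Set.univ * ∫⁻ t, κ₁ t ∂lamA α) ^ p * ε) / 2⁻¹ ^ p := by
        gcongr
        exact (lintegral_besselConv_rpow_le hα hpp h₁ hf).trans (by gcongr)
    _ = B * ε := by rw [hB, div_eq_mul_inv, div_eq_mul_inv, mul_right_comm]

end BesselCapacity

theorem mainTheorem12 (n : ℕ) (hn : 1 ≤ n) (α : Fin n → ℝ) (hα : ∀ i, -(1 / 2 : ℝ) < α i)
    (p p' : ℝ) (hp : 1 < p) (hp' : 1 / p + 1 / p' = 1)
    (κ : EuclideanSpace ℝ (Fin n) → ℝ≥0∞)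
    (hκ : BesselCapacity.IsRadiallyDecreasingKernel α κ) :
    (eLpNorm κ (ENNReal.ofReal p') (BesselCapacity.lamA α) < ∞ →
      ∀ y ∈ interior (BesselCapacity.orthant n), 0 < BesselCapacity.capacity α p κ {y}) ∧
    ((∫⁻ x in BesselCapacity.orthant n \ Metric.ball 0 1, κ x ^ p' ∂(BesselCapacity.lamA α)) = ∞ →
      ∀ E ⊆ BesselCapacity.orthant n, BesselCapacity.capacity α p κ E = 0) ∧
    ((∫⁻ x in BesselCapacity.orthant n \ Metric.ball 0 1, κ x ^ p' ∂(BesselCapacity.lamA α)) < ∞ →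
      ∀ E ⊆ BesselCapacity.orthant n, NullMeasurableSet E volume →
        BesselCapacity.capacity α p κ E = 0 → BesselCapacity.lamA α E = 0) := by
  open BesselCapacity in
  have hpp : p'.HolderConjugate p := by
    refine (Real.holderConjugate_iff.2 ⟨hp, ?_⟩).symm
    simpa only [one_div] using hp'
  obtain ⟨g, hg, hint, hκg⟩ := hκ.exists_antitone
  obtain rfl : κ = fun x => g ‖x‖ := funext hκg
  have hκm : Measurable fun x : EuclideanSpace ℝ (Fin n) => g ‖x‖ :=
    hg.measurable.comp measurable_norm
  have hp'0 : ENNReal.ofReal p' ≠ 0 := by simpa using hpp.pos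
  simp_rw [setLIntegral_orthant_diff]
  refine ⟨fun h y _ => ?_, fun h E _ => ?_, fun h E _ _ hE => ?_⟩
  · refine capacity_singleton_pos hα hpp hκm ?_ y
    simpa [ENNReal.toReal_ofReal hpp.nonneg] using
      (eLpNorm_lt_top_iff_lintegral_rpow_enorm_lt_top hp'0 ENNReal.ofReal_ne_top).1 h
  · have hU : E ⊆ ⋃ m : ℕ, Metric.closedBall 0 ((m : ℝ) + 1) := fun x _ => by
      obtain ⟨m, hm⟩ := exists_nat_ge ‖x‖
      exact Set.mem_iUnion.2 ⟨m, by simpa using hm.trans (by linarith)⟩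
    refine le_antisymm ?_ zero_le
    rw [← capacity_iUnion_eq_zero (α := α) (p := p) hpp.symm.pos fun m : ℕ =>
      capacity_closedBall_eq_zero hα hpp hg (apply_one_lt_top (homDim_pos hn hα) hg hint) h
        (show (1 : ℝ) ≤ m + 1 by simp)]
    exact capacity_mono hU
  -- The part of the kernel inside the unit ball is integrable by the condition on `g`, the part
  -- outside is in `L^{p'}` by assumption.
  · have hb : MeasurableSet (Metric.ball (0 : EuclideanSpace ℝ (Fin n)) 1) := measurableSet_ball
    refine lamA_eq_zero_of_capacity_eq_zero hα hpp (hκm.indicator hb) (hκm.indicator hb.compl)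
      ?_ ?_ (E := E) ?_
    · rw [lintegral_indicator hb]
      refine (lintegral_mono_set Metric.ball_subset_closedBall).trans_lt ?_
      rw [setLIntegral_closedBall_radial hn hα hg.measurable]
      exact ENNReal.mul_lt_top (ENNReal.mul_lt_top (lamA_closedBall_lt_top hα 1)
        ENNReal.ofReal_lt_top) hint
    · convert h using 1
      rw [← lintegral_indicator hb.compl]
      refine lintegral_congr fun x => ?_
      by_cases hx : x ∈ Metric.ball (0 : EuclideanSpace ℝ (Fin n)) 1 <;>
        simp [Set.indicator, hx, hpp.pos]
    · convert hE using 2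
      exact Set.indicator_self_add_compl (Metric.ball 0 1) fun x => g ‖x‖
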